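/- Let $\mathcal H_S$ be a finite-dimensional and $\mathcal H_A$ a separable complex Hilbert space, and let $\mathcal L(\mathcal H)$ and $\mathcal T(\mathcal H)$ denote the bounded and the trace-class operators on $\mathcal H$. A channel is a completely positive, trace-preserving linear map $\Phi$ between spaces of trace-class operators; its dual $\Phi^*$ is determined by $\mathrm{tr}[\Phi^*(A)T]=\mathrm{tr}[A\,\Phi(T)]$, and duals of completely positive, trace non-increasing maps (operations) are defined in the same way. An observable with countable value space $\mathcal X$ is a family $\{\mathsf E(x)\}_{x\in\mathcal X}$ of positive operators with $\sum_x \mathsf E(x)=\mathbb 1$ (strongly); an effect is non-trivial if it is not a multiple of $\mathbb 1$, and an observable is non-trivial if one of its effects is. An instrument on $\mathcal H_S$ is a family $\mathcal I=\{\mathcal I_x\}_{x\in\mathcal X}$ of operations on $\mathcal T(\mathcal H_S)$ whose sum $\mathcal I_{\mathcal X}=\sum_x\mathcal I_x$ is a channel; it is an $\mathsf E$-instrument if $\mathcal I_x^*(\mathbb 1)=\mathsf E(x)$ for all $x$. \textbf{Theorem.} Let $\mathsf E=\{\mathsf E(x)\}_{x\in\mathcal X}$ be a non-trivial observable on $\mathcal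 H_S$, let $\mathcal I$ be an $\mathsf E$-instrument, and let $\mathcal M=(\mathcal H_A,\xi,\mathcal E,\mathsf Z)$ be a measurement scheme for $\mathcal I$: $\xi$ is a state (positive trace-class operator of trace one) on $\mathcal H_A$, $\mathcal E$ is a channel on $\mathcal T(\mathcal H_S\otimes\mathcal H_A)$, $\mathsf Z=\{\mathsf Z(x)\}_{x\in\mathcal X}$ is an observable on $\mathcal H_A$, and $$\mathcal I_x(T)=\mathrm{tr}_A\big[(\mathbb 1\otimes \mathsf Z(x))\,\mathcal E(T\otimes\xi)\big]\qquad\text{for all } T\in\mathcal T(\mathcal H_S),\ x\in\mathcal X .$$ Assume that $\mathcal I$ is a measurement of the first kind, i.e. $\mathcal I_{\mathcal X}^*(\mathsf E(y))=\mathsf E(y)$ for all $y\in\mathcal X$, and that $\mathcal E$ conserves on average an additive quantity $N=N_S\otimes\mathbb 1+\mathbb 1\otimes N_A$ with $N_S\in\mathcal L(\mathcal H_S)$, $N_A\in\mathcal L(\mathcal H_A)$ self-adjoint, i.e. $\mathrm{tr}[N\mathcal E(\rho)]=\mathrm{tr}[N\rho]$ for all states $\rho$ on $\mathcal H_S\otimes\mathcal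 H_A$. Then for every $x\in\mathcal X$ such that the effect $\mathsf E(x)$ is non-trivial, and for all unit vectors $\psi,\phi\in\mathcal H_S$ with $\mathsf E(x)\psi=\|\mathsf E(x)\|\psi$ and $(\mathbb 1-\mathsf E(x))\phi=\|\mathbb 1-\mathsf E(x)\|\phi$, $$|\langle\psi| N_S\phi\rangle|\le \|N_S\|\Big(\|\mathsf E(x)\|^{1/2}\big(1-\|\mathbb 1-\mathsf E(x)\|\big)^{1/2}+\big(1-\|\mathsf E(x)\|\big)^{1/2}\|\mathbb 1-\mathsf E(x)\|^{1/2}\Big).$$ -/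

import Mathlib

open scoped TensorProduct ComplexOrder InnerProductSpace

noncomputable section

namespace WAY

/-! ### Trace-class operators and the trace -/

section TraceClass

variable {H : Type*} [NormedAddCommGroup H] [InnerProductSpace ℂ H]

/-- `T` is trace class (nuclear): `T = ∑ₙ |uₙ⟩⟨vₙ|` with `∑ₙ ‖uₙ‖ ‖vₙ‖ < ∞`. On a Hilbert space
these are exactly the operators with `tr |T| < ∞`. -/
def IsTraceClass (T : H →L[ℂ] H) : Prop :=
  ∃ u v : ℕ → H, Summable (fun n => ‖u n‖ * ‖v n‖) ∧
    HasSum (fun n => InnerProductSpace.rankOne ℂ (u n) (v n)) T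

theorem IsTraceClass.of_hasSum {ι : Type*} [Denumerable ι] {T : H →L[ℂ] H} (u v : ι → H)
    (hs : Summable (fun n => ‖u n‖ * ‖v n‖))
    (hT : HasSum (fun n => InnerProductSpace.rankOne ℂ (u n) (v n)) T) : IsTraceClass T := by
  let e : ℕ ≃ ι := (Denumerable.eqv ι).symm
  exact ⟨u ∘ e, v ∘ e, (e.summable_iff (f := fun n => ‖u n‖ * ‖v n‖)).2 hs,
    (e.hasSum_iff (f := fun n => InnerProductSpace.rankOne ℂ (u n) (v n))).2 hT⟩

variable (H) in
/-- The space `𝒯(H)` of trace-class operators on `H`. -/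
def TraceClass : Submodule ℂ (H →L[ℂ] H) where
  carrier := {T | IsTraceClass T}
  zero_mem' := ⟨0, 0, by simp [summable_zero], by simp [hasSum_zero]⟩
  add_mem' := by
    rintro S T ⟨u, v, hs, hS⟩ ⟨u', v', hs', hT⟩
    refine IsTraceClass.of_hasSum (ι := ℕ ⊕ ℕ) (Sum.elim u u') (Sum.elim v v') ?_ ?_
    · exact (HasSum.sum (f := fun n : ℕ ⊕ ℕ => ‖Sum.elim u u' n‖ * ‖Sum.elim v v' n‖)
        hs.hasSum hs'.hasSum).summable
    · exact HasSum.sum (f := fun n : ℕ ⊕ ℕ =>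
        InnerProductSpace.rankOne ℂ (Sum.elim u u' n) (Sum.elim v v' n)) hS hT
  smul_mem' := by
    rintro c T ⟨u, v, hs, hT⟩
    refine ⟨fun n => c • u n, v, ?_, ?_⟩
    · simpa [norm_smul, mul_assoc] using hs.mul_left ‖c‖
    · simpa using hT.const_smul c

/-- The trace `tr T = ∑ᵢ ⟨eᵢ, T eᵢ⟩` over an orthonormal basis (for trace-class `T` the sum
converges absolutely and does not depend on the basis). -/
def trace [CompleteSpace H] (T : H →L[ℂ] H) : ℂ :=
  ∑' i, inner ℂ ((exists_hilbertBasis ℂ H).choose_spec.choose i)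
    (T ((exists_hilbertBasis ℂ H).choose_spec.choose i))

/-- A (normal) state: a positive trace-class operator of unit trace. -/
def IsState [CompleteSpace H] (ρ : TraceClass H) : Prop :=
  (ρ : H →L[ℂ] H).IsPositive ∧ trace (ρ : H →L[ℂ] H) = 1

end TraceClass

/-! ### The Hilbert space tensor product -/

section Tensor

variable {H K : Type*} [NormedAddCommGroup H] [InnerProductSpace ℂ H]
  [NormedAddCommGroup K] [InnerProductSpace ℂ K]

variable (H K) in
/-- The Hilbert space tensor product: the completion of the algebraic tensor product with respect
to `⟨a ⊗ b, c ⊗ d⟩ = ⟨a, c⟩ ⟨b, d⟩`. -/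
def HTensor : Type _ := UniformSpace.Completion (H ⊗[ℂ] K)

instance : NormedAddCommGroup (HTensor H K) :=
  inferInstanceAs (NormedAddCommGroup (UniformSpace.Completion (H ⊗[ℂ] K)))

instance : InnerProductSpace ℂ (HTensor H K) :=
  inferInstanceAs (InnerProductSpace ℂ (UniformSpace.Completion (H ⊗[ℂ] K)))

instance : CompleteSpace (HTensor H K) :=
  inferInstanceAs (CompleteSpace (UniformSpace.Completion (H ⊗[ℂ] K)))

variable (H K) in
/-- The canonical isometric embedding of the algebraic tensor product. -/
def toHTensor : H ⊗[ℂ] K →ₗᵢ[ℂ] HTensor H K :=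
  UniformSpace.Completion.toComplₗᵢ (𝕜 := ℂ) (E := H ⊗[ℂ] K)

theorem denseRange_toHTensor : DenseRange (toHTensor H K) :=
  UniformSpace.Completion.denseRange_coe (α := H ⊗[ℂ] K)

/-- The elementary tensor `x ⊗ y` in the Hilbert space tensor product. -/
def tmul (x : H) (y : K) : HTensor H K := toHTensor H K (x ⊗ₜ[ℂ] y)

/-- The bounded operator `A ⊗ B` on the Hilbert space tensor product, the continuous extension of
the algebraic tensor product of `A` and `B`. -/
def opTensor (A : H →L[ℂ] H) (B : K →L[ℂ] K) : HTensor H K →L[ℂ] HTensor H K :=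
  ((toHTensor H K).toContinuousLinearMap ∘L TensorProduct.mapL A B).extend
    (toHTensor H K).toContinuousLinearMap

theorem opTensor_coe (A : H →L[ℂ] H) (B : K →L[ℂ] K) (z : H ⊗[ℂ] K) :
    opTensor A B (toHTensor H K z) = toHTensor H K (TensorProduct.mapL A B z) :=
  ContinuousLinearMap.extend_eq
    (f := (toHTensor H K).toContinuousLinearMap ∘L TensorProduct.mapL A B)
    (e := (toHTensor H K).toContinuousLinearMap)
    denseRange_toHTensor (toHTensor H K).isometry.isUniformInducing z

theorem opTensor_tmul (A : H →L[ℂ] H) (B : K →L[ℂ] K) (x : H) (y : K) :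
    opTensor A B (tmul x y) = tmul (A x) (B y) := by
  simp only [tmul, opTensor_coe, TensorProduct.mapL_tmul]

theorem add_tmul (x x' : H) (y : K) : tmul (x + x') y = tmul x y + tmul x' y := by
  simp only [tmul, TensorProduct.add_tmul, map_add]

theorem tmul_add (x : H) (y y' : K) : tmul x (y + y') = tmul x y + tmul x y' := by
  simp only [tmul, TensorProduct.tmul_add, map_add]

theorem smul_tmul (c : ℂ) (x : H) (y : K) : tmul (c • x) y = c • tmul x y := by
  simp only [tmul, ← TensorProduct.smul_tmul', map_smul]

theorem tmul_smul (c : ℂ) (x : H) (y : K) : tmul x (c • y) = c • tmul x y := by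
  simp only [tmul, TensorProduct.tmul_smul, map_smul]

theorem inner_tmul (x x' : H) (y y' : K) :
    inner ℂ (tmul x y) (tmul x' y') = inner ℂ x x' * inner ℂ y y' := by
  simp only [tmul, LinearIsometry.inner_map_map, TensorProduct.inner_tmul]

theorem norm_tmul (x : H) (y : K) : ‖tmul x y‖ = ‖x‖ * ‖y‖ := by
  simp only [tmul, LinearIsometry.norm_map, TensorProduct.norm_tmul]

theorem htensor_ext {S T : HTensor H K →L[ℂ] HTensor H K}
    (h : ∀ x y, S (tmul x y) = T (tmul x y)) : S = T := by
  have key : ∀ z : H ⊗[ℂ] K, S (toHTensor H K z) = T (toHTensor H K z) := by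
    intro z
    induction z with
    | zero => rw [map_zero, map_zero, map_zero]
    | tmul x y => exact h x y
    | add a b ha hb => rw [map_add, map_add, map_add, ha, hb]
  exact DFunLike.coe_injective
    (denseRange_toHTensor.equalizer S.continuous T.continuous (funext key))

theorem norm_opTensor_le (A : H →L[ℂ] H) (B : K →L[ℂ] K) : ‖opTensor A B‖ ≤ ‖A‖ * ‖B‖ := by
  refine ContinuousLinearMap.opNorm_le_bound _ (by positivity) fun z => ?_
  induction z using denseRange_toHTensor.induction_on with
  | hp => exact isClosed_le (by fun_prop) (by fun_prop)
  | ih a =>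
    rw [opTensor_coe, LinearIsometry.norm_map, LinearIsometry.norm_map]
    exact (ContinuousLinearMap.le_opNorm _ _).trans
      (mul_le_mul_of_nonneg_right (TensorProduct.norm_mapL_le A B) (norm_nonneg _))

theorem opTensor_add_left (A A' : H →L[ℂ] H) (B : K →L[ℂ] K) :
    opTensor (A + A') B = opTensor A B + opTensor A' B :=
  htensor_ext fun x y => by
    rw [add_apply, opTensor_tmul, opTensor_tmul, opTensor_tmul, add_apply, add_tmul]

theorem opTensor_add_right (A : H →L[ℂ] H) (B B' : K →L[ℂ] K) :
    opTensor A (B + B') = opTensor A B + opTensor A B' :=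
  htensor_ext fun x y => by
    rw [add_apply, opTensor_tmul, opTensor_tmul, opTensor_tmul, add_apply, tmul_add]

theorem opTensor_smul_left (c : ℂ) (A : H →L[ℂ] H) (B : K →L[ℂ] K) :
    opTensor (c • A) B = c • opTensor A B :=
  htensor_ext fun x y => by
    rw [smul_apply, opTensor_tmul, opTensor_tmul, smul_apply, smul_tmul]

theorem opTensor_smul_right (c : ℂ) (A : H →L[ℂ] H) (B : K →L[ℂ] K) :
    opTensor A (c • B) = c • opTensor A B :=
  htensor_ext fun x y => by
    rw [smul_apply, opTensor_tmul, opTensor_tmul, smul_apply, tmul_smul]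

variable (H K) in
/-- `opTensor` as a bounded bilinear map. -/
def opTensorL : (H →L[ℂ] H) →L[ℂ] (K →L[ℂ] K) →L[ℂ] (HTensor H K →L[ℂ] HTensor H K) :=
  LinearMap.mkContinuous₂
    (LinearMap.mk₂ ℂ (fun (A : H →L[ℂ] H) (B : K →L[ℂ] K) => opTensor A B)
      opTensor_add_left opTensor_smul_left opTensor_add_right opTensor_smul_right)
    1 (fun A B => by
      rw [one_mul]
      exact norm_opTensor_le A B)

theorem opTensorL_apply (A : H →L[ℂ] H) (B : K →L[ℂ] K) : opTensorL H K A B = opTensor A B := rfl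

theorem opTensor_rankOne (u v : H) (a b : K) :
    opTensor (InnerProductSpace.rankOne ℂ u v) (InnerProductSpace.rankOne ℂ a b) =
      InnerProductSpace.rankOne ℂ (tmul u a) (tmul v b) := by
  refine htensor_ext fun x y => ?_
  rw [opTensor_tmul]
  simp only [InnerProductSpace.rankOne_apply]
  rw [smul_tmul, tmul_smul, smul_smul]
  rw [inner_tmul]

theorem IsTraceClass.tensor {T : H →L[ℂ] H} {S : K →L[ℂ] K} (hT : IsTraceClass T)
    (hS : IsTraceClass S) : IsTraceClass (opTensor T S) := by
  obtain ⟨u, v, hs, hT⟩ := hT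
  obtain ⟨a, b, hs', hS⟩ := hS
  have hsum : Summable (fun p : ℕ × ℕ => ‖tmul (u p.1) (a p.2)‖ * ‖tmul (v p.1) (b p.2)‖) := by
    refine (hs.mul_of_nonneg hs' (fun _ => by positivity) (fun _ => by positivity)).congr ?_
    intro p
    simp only [norm_tmul]
    ring
  have hop : Summable (fun p : ℕ × ℕ =>
      InnerProductSpace.rankOne ℂ (tmul (u p.1) (a p.2)) (tmul (v p.1) (b p.2))) :=
    Summable.of_norm (by simpa using hsum)
  refine IsTraceClass.of_hasSum (ι := ℕ × ℕ) (fun p => tmul (u p.1) (a p.2))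
    (fun p => tmul (v p.1) (b p.2)) hsum ?_
  have h1 := hop.hasSum.prod_fiberwise
    (g := fun n => opTensor (InnerProductSpace.rankOne ℂ (u n) (v n)) S) (fun n => by
      have h := (opTensorL H K (InnerProductSpace.rankOne ℂ (u n) (v n))).hasSum hS
      simpa only [opTensorL_apply, opTensor_rankOne, Function.comp_def] using h)
  have h2 : HasSum (fun n => opTensor (InnerProductSpace.rankOne ℂ (u n) (v n)) S)
      (opTensor T S) := by
    have h := ((opTensorL H K).flip S).hasSum hT
    simpa only [ContinuousLinearMap.flip_apply, opTensorL_apply, Function.comp_def] using h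
  rw [← h1.unique h2]
  exact hop.hasSum

/-- The trace-class operator `T ⊗ S` for trace-class `T` and `S`. -/
def tensorTC (T : TraceClass H) (S : TraceClass K) : TraceClass (HTensor H K) :=
  ⟨opTensor (T : H →L[ℂ] H) (S : K →L[ℂ] K), T.2.tensor S.2⟩

/-- The additive quantity `N_S ⊗ 1 + 1 ⊗ N_A`. -/
def additive (NS : H →L[ℂ] H) (NA : K →L[ℂ] K) : HTensor H K →L[ℂ] HTensor H K :=
  opTensor NS 1 + opTensor 1 NA

variable [CompleteSpace H]

/-- `S` is the partial trace of `W` over the second factor: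
`tr[A S] = tr[(A ⊗ 1) W]` for all bounded `A`. -/
def IsPartialTrace (S : TraceClass H) (W : HTensor H K →L[ℂ] HTensor H K) : Prop :=
  ∀ A : H →L[ℂ] H, trace (A * (S : H →L[ℂ] H)) = trace (opTensor A (1 : K →L[ℂ] K) * W)

end Tensor

/-! ### Operations, channels, observables, instruments, measurement schemes -/

section Measurement

variable {X : Type*} {H K : Type*} [NormedAddCommGroup H] [InnerProductSpace ℂ H]
  [NormedAddCommGroup K] [InnerProductSpace ℂ K]

/-- The block operator `[Tᵢⱼ]` is positive on `H ⊕ ⋯ ⊕ H` (`n` summands). -/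
def BlockPositive {n : ℕ} (T : Fin n → Fin n → TraceClass H) : Prop :=
  ∀ v : Fin n → H, (0 : ℂ) ≤ ∑ i, ∑ j, inner ℂ (v i) ((T i j : H →L[ℂ] H) (v j))

/-- Complete positivity of a linear map `𝒯(H) → 𝒯(K)`: every amplification `id ⊗ Φ` to `n × n`
block operators preserves positivity. -/
def IsCompletelyPositive (Φ : TraceClass H →ₗ[ℂ] TraceClass K) : Prop :=
  ∀ (n : ℕ) (T : Fin n → Fin n → TraceClass H),
    BlockPositive T → BlockPositive (fun i j => Φ (T i j))

variable [CompleteSpace H] [CompleteSpace K]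

variable (H K) in
/-- An operation: a completely positive, trace non-increasing linear map `𝒯(H) → 𝒯(K)`. -/
structure Operation where
  toLin : TraceClass H →ₗ[ℂ] TraceClass K
  completelyPositive : IsCompletelyPositive toLin
  trace_le : ∀ T : TraceClass H, (T : H →L[ℂ] H).IsPositive →
    (trace (toLin T : K →L[ℂ] K)).re ≤ (trace (T : H →L[ℂ] H)).re

/-- A channel is a trace-preserving operation. -/
def Operation.IsChannel (Φ : Operation H K) : Prop :=
  ∀ T : TraceClass H, trace (Φ.toLin T : K →L[ℂ] K) = trace (T : H →L[ℂ] H)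

/-- `B = Φ^*(A)` for the Heisenberg dual `Φ^*` of `Φ`: `tr[B T] = tr[A Φ(T)]` for all trace-class
`T`. -/
def Operation.IsDualValue (Φ : Operation H K) (A : K →L[ℂ] K) (B : H →L[ℂ] H) : Prop :=
  ∀ T : TraceClass H, trace (B * (T : H →L[ℂ] H)) = trace (A * (Φ.toLin T : K →L[ℂ] K))

/-- The fixed-point set `{A : Φ^*(A) = A}` of the dual of `Φ`. -/
def Operation.dualFixedPoints (Φ : Operation H H) : Set (H →L[ℂ] H) :=
  {A | Φ.IsDualValue A A}

/-- `Φ` conserves `N` on average: `tr[N Φ(ρ)] = tr[N ρ]` for all states `ρ`. -/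
def Operation.ConservesOnAverage (Φ : Operation H H) (N : H →L[ℂ] H) : Prop :=
  ∀ ρ : TraceClass H, IsState ρ →
    trace (N * (Φ.toLin ρ : H →L[ℂ] H)) = trace (N * (ρ : H →L[ℂ] H))

variable (X H) in
/-- A discrete observable (normalised POVM on the value space `X`): positive operators `E x` with
`∑ₓ E x = 1` in the strong operator topology. -/
structure Observable where
  effect : X → H →L[ℂ] H
  isPositive : ∀ x, (effect x).IsPositive
  hasSum_apply : ∀ ψ : H, HasSum (fun x => effect x ψ) ψ

/-- An effect is non-trivial if it is not a multiple of the identity. -/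
def NontrivialEffect (A : H →L[ℂ] H) : Prop := ∀ c : ℂ, A ≠ c • (1 : H →L[ℂ] H)

/-- An observable is non-trivial if some of its effects is non-trivial. -/
def Observable.IsNontrivial (E : Observable X H) : Prop := ∃ x, NontrivialEffect (E.effect x)

variable (X H) in
/-- A discrete instrument: operations `I x` on `𝒯(H)` whose sum `I_X` is a channel. -/
structure Instrument where
  op : X → Operation H H
  total : Operation H H
  hasSum_op : ∀ T : TraceClass H,
    HasSum (fun x => ((op x).toLin T : H →L[ℂ] H)) (total.toLin T : H →L[ℂ] H)
  isChannel : total.IsChannel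

/-- `I` is an `E`-instrument: `I_x^*(1) = E(x)` for all `x`. -/
def Instrument.IsCompatible (I : Instrument X H) (E : Observable X H) : Prop :=
  ∀ x, (I.op x).IsDualValue 1 (E.effect x)

/-- The `E`-instrument `I` is a measurement of the first kind: every effect of `E` is a fixed point
of `I_X^*`. -/
def Instrument.IsFirstKind (I : Instrument X H) (E : Observable X H) : Prop :=
  ∀ x, E.effect x ∈ I.total.dualFixedPoints

variable (X H K) in
/-- A measurement scheme on the system `H` with apparatus `K`: a state `ξ` of the apparatus, an
interaction channel on the compound, and a pointer observable of the apparatus. -/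
structure MeasurementScheme where
  probe : TraceClass K
  isState_probe : IsState probe
  interaction : Operation (HTensor H K) (HTensor H K)
  isChannel_interaction : interaction.IsChannel
  pointer : Observable X K

/-- The scheme implements the instrument `I`:
`I_x(T) = tr_A[(1 ⊗ Z(x)) 𝓔(T ⊗ ξ)]` for all `x` and all trace-class `T`. -/
def MeasurementScheme.Implements (M : MeasurementScheme X H K) (I : Instrument X H) : Prop :=
  ∀ (x : X) (T : TraceClass H), IsPartialTrace ((I.op x).toLin T)
    (opTensor (1 : H →L[ℂ] H) (M.pointer.effect x) *
      (M.interaction.toLin (tensorTC T M.probe) : HTensor H K →L[ℂ] HTensor H K))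

/-- The eigenspace of `A` for the eigenvalue `‖A‖`. -/
def topEigenspace (A : H →L[ℂ] H) : Submodule ℂ H :=
  Module.End.eigenspace (A : H →ₗ[ℂ] H) (‖A‖ : ℂ)

end Measurement

end WAY

end

open scoped TensorProduct ComplexOrder InnerProductSpace

noncomputable section

namespace WAY

/-! ### Trace-class operators: the trace, its duality with bounded operators, and block
Cauchy–Schwarz. -/

section TraceTheory

variable {H : Type*} [NormedAddCommGroup H] [InnerProductSpace ℂ H]

/-! Write `ω u v = 𝓔(|u⟩⟨v| ⊗ ξ)` (`evolve`). Polarised conservation gives `tr[N ω φ ψ] = ⟨ψ, N_S φ⟩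
+ ⟨ψ, φ⟩ tr[N_A ξ]`, and `ψ ⟂ φ` since they are eigenvectors of `E(x)` for the distinct eigenvalues
`‖E(x)‖` and `1 - ‖1 - E(x)‖`.

The apparatus term `tr[(1 ⊗ N_A) ω φ ψ]` vanishes. The first-kind property keeps `ω ψ ψ` and `ω φ φ`
in the top eigenspaces of `E(x)` and `1 - E(x)` (`re_tracePairing_norm_sub_le`). Complete positivity
makes the `2 × 2` block of the `ω`'s positive, so Cauchy–Schwarz
(`BlockPositive.norm_tracePairing_sq_le`) passes this to the off-diagonal entry: both `‖E(x)‖ -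
E(x)` and `‖1 - E(x)‖ - (1 - E(x))`, tensored with `N_A`, pair to zero with `ω φ ψ`. Their sum is a
nonzero multiple of `1 ⊗ N_A`, by non-triviality.

Hence `⟨ψ, N_S φ⟩ = tr[(N_S ⊗ 1) ω φ ψ]`. Splitting `1 = Z(x) + (1 - Z(x))` and applying
Cauchy–Schwarz to each part (`norm_tracePairing_opTensor_le`) yields the two products of outcome
probabilities. -/

theorem isTraceClass_rankOne (u v : H) : IsTraceClass (InnerProductSpace.rankOne ℂ u v) := by
  refine ⟨fun n => if n = 0 then u else 0, fun n => if n = 0 then v else 0, ?_, ?_⟩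
  · exact summable_of_ne_finset_zero (s := {0}) fun n hn => by simp_all
  · convert hasSum_single (0 : ℕ) ?_ using 1
    · simp
    · intro n hn
      simp [hn]

/-- The rank-one operator `|u⟩⟨v|` as a trace-class operator. -/
def rankOneTC (u v : H) : TraceClass H :=
  ⟨InnerProductSpace.rankOne ℂ u v, isTraceClass_rankOne u v⟩

theorem coe_rankOneTC (u v : H) :
    (rankOneTC u v : H →L[ℂ] H) = InnerProductSpace.rankOne ℂ u v := rfl

/-- Cauchy–Schwarz and Bessel bound each inner sum by `‖u n‖ * ‖v n‖`; absolute convergence of the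
double series then permits exchanging the two summations. -/
theorem summable_inner_mul_of_orthonormal {ι : Type*} {b : ι → H} (hb : Orthonormal ℂ b)
    {u v : ℕ → H} (hs : Summable (fun n => ‖u n‖ * ‖v n‖)) :
    Summable (fun p : ℕ × ι => inner ℂ (v p.1) (b p.2) * inner ℂ (b p.2) (u p.1)) := by
  have bound : ∀ (n : ℕ) (s : Finset ι),
      ∑ i ∈ s, ‖inner ℂ (v n) (b i) * inner ℂ (b i) (u n)‖ ≤ ‖u n‖ * ‖v n‖ := by
    intro n s
    have h1 := Real.sum_mul_le_sqrt_mul_sqrt s (fun i => ‖inner ℂ (b i) (v n)‖)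
      (fun i => ‖inner ℂ (b i) (u n)‖)
    have h2 : √(∑ i ∈ s, ‖inner ℂ (b i) (v n)‖ ^ 2) ≤ ‖v n‖ :=
      Real.sqrt_le_iff.2 ⟨norm_nonneg _, hb.sum_inner_products_le _⟩
    have h3 : √(∑ i ∈ s, ‖inner ℂ (b i) (u n)‖ ^ 2) ≤ ‖u n‖ :=
      Real.sqrt_le_iff.2 ⟨norm_nonneg _, hb.sum_inner_products_le _⟩
    calc ∑ i ∈ s, ‖inner ℂ (v n) (b i) * inner ℂ (b i) (u n)‖
        = ∑ i ∈ s, ‖inner ℂ (b i) (v n)‖ * ‖inner ℂ (b i) (u n)‖ := by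
          refine Finset.sum_congr rfl fun i _ => ?_
          rw [norm_mul, norm_inner_symm]
      _ ≤ _ := h1
      _ ≤ ‖v n‖ * ‖u n‖ := by gcongr
      _ = _ := mul_comm _ _
  refine Summable.of_norm ?_
  refine (summable_prod_of_nonneg fun _ => norm_nonneg _).2 ⟨fun n => ?_, ?_⟩
  · exact summable_of_sum_le (fun _ => norm_nonneg _) (bound n)
  · exact hs.of_nonneg_of_le (fun n => tsum_nonneg fun _ => norm_nonneg _) fun n =>
      Real.tsum_le_of_sum_le (fun _ => norm_nonneg _) (bound n)

theorem IsTraceClass.mul_left {T : H →L[ℂ] H} (hT : IsTraceClass T) (B : H →L[ℂ] H) :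
    IsTraceClass (B * T) := by
  obtain ⟨u, v, hs, hT⟩ := hT
  refine ⟨fun n => B (u n), v, ?_, ?_⟩
  · refine (hs.mul_left ‖B‖).of_nonneg_of_le (fun _ => by positivity) fun n => ?_
    rw [← mul_assoc]
    gcongr
    exact B.le_opNorm _
  · simpa only [ContinuousLinearMap.mul_def, InnerProductSpace.comp_rankOne] using
      hT.mul_left B

variable [CompleteSpace H]

theorem IsTraceClass.mul_right {T : H →L[ℂ] H} (hT : IsTraceClass T) (B : H →L[ℂ] H) :
    IsTraceClass (T * B) := by
  obtain ⟨u, v, hs, hT⟩ := hT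
  refine ⟨u, fun n => ContinuousLinearMap.adjoint B (v n), ?_, ?_⟩
  · refine (hs.mul_left ‖ContinuousLinearMap.adjoint B‖).of_nonneg_of_le
      (fun _ => by positivity) fun n => ?_
    rw [mul_left_comm]
    gcongr
    exact ContinuousLinearMap.le_opNorm _ _
  · simpa only [ContinuousLinearMap.mul_def, InnerProductSpace.rankOne_comp] using
      hT.mul_right B

variable (H) in
/-- The index set of the Hilbert basis that defines `trace`. -/
abbrev traceIndex : Set H := (exists_hilbertBasis ℂ H).choose

variable (H) in
/-- The Hilbert basis that defines `trace`. -/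
def traceBasis : HilbertBasis (traceIndex H) ℂ H :=
  (exists_hilbertBasis ℂ H).choose_spec.choose

theorem trace_eq_tsum (T : H →L[ℂ] H) :
    trace T = ∑' i, inner ℂ (traceBasis H i) (T (traceBasis H i)) := rfl

/-- Both sides are iterated sums of one double series: summing over the basis first is Parseval,
summing over `n` first gives the diagonal entries of `T`. The trace is thereby computed from any
nuclear decomposition. -/
theorem hasSum_inner_traceBasis_aux {T : H →L[ℂ] H} {u v : ℕ → H}
    (hs : Summable (fun n => ‖u n‖ * ‖v n‖))
    (hT : HasSum (fun n => InnerProductSpace.rankOne ℂ (u n) (v n)) T) :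
    HasSum (fun i => inner ℂ (traceBasis H i) (T (traceBasis H i)))
      (∑' n, inner ℂ (v n) (u n)) := by
  have hsum := summable_inner_mul_of_orthonormal (traceBasis H).orthonormal hs
  have h1 := hsum.hasSum.prod_fiberwise
    (fun n => (traceBasis H).hasSum_inner_mul_inner (v n) (u n))
  have h2 := (Equiv.prodComm _ _).hasSum_iff.2 hsum.hasSum |>.prod_fiberwise
    (g := fun i => inner ℂ (traceBasis H i) (T (traceBasis H i))) (fun i => by
      have h := (innerSL ℂ (traceBasis H i)).hasSum
        ((ContinuousLinearMap.apply ℂ H (traceBasis H i)).hasSum hT)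
      simpa [inner_smul_right] using h)
  rwa [h1.tsum_eq]

theorem trace_eq_of_hasSum {T : H →L[ℂ] H} {u v : ℕ → H}
    (hs : Summable (fun n => ‖u n‖ * ‖v n‖))
    (hT : HasSum (fun n => InnerProductSpace.rankOne ℂ (u n) (v n)) T) :
    trace T = ∑' n, inner ℂ (v n) (u n) :=
  (hasSum_inner_traceBasis_aux hs hT).tsum_eq

theorem IsTraceClass.hasSum_trace {T : H →L[ℂ] H} (hT : IsTraceClass T) :
    HasSum (fun i => inner ℂ (traceBasis H i) (T (traceBasis H i))) (trace T) := by
  obtain ⟨u, v, hs, h⟩ := hT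
  rw [trace_eq_of_hasSum hs h]
  exact hasSum_inner_traceBasis_aux hs h

theorem trace_add {S T : H →L[ℂ] H} (hS : IsTraceClass S) (hT : IsTraceClass T) :
    trace (S + T) = trace S + trace T := by
  refine HasSum.tsum_eq ?_
  simpa [inner_add_right, traceBasis] using hS.hasSum_trace.add hT.hasSum_trace

theorem trace_smul (c : ℂ) {T : H →L[ℂ] H} (hT : IsTraceClass T) :
    trace (c • T) = c * trace T := by
  refine HasSum.tsum_eq ?_
  simpa [inner_smul_right, traceBasis] using hT.hasSum_trace.mul_left c

theorem trace_mul_eq_of_hasSum {T : H →L[ℂ] H} (B : H →L[ℂ] H) {u v : ℕ → H}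
    (hs : Summable (fun n => ‖u n‖ * ‖v n‖))
    (hT : HasSum (fun n => InnerProductSpace.rankOne ℂ (u n) (v n)) T) :
    trace (B * T) = ∑' n, inner ℂ (v n) (B (u n)) := by
  refine trace_eq_of_hasSum (u := fun n => B (u n)) ?_ ?_
  · refine (hs.mul_left ‖B‖).of_nonneg_of_le (fun _ => by positivity) fun n => ?_
    rw [← mul_assoc]
    gcongr
    exact B.le_opNorm _
  · simpa only [ContinuousLinearMap.mul_def, InnerProductSpace.comp_rankOne] using
      hT.mul_left B

theorem trace_mul_comm {T : H →L[ℂ] H} (hT : IsTraceClass T) (B : H →L[ℂ] H) :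
    trace (T * B) = trace (B * T) := by
  obtain ⟨u, v, hs, hT⟩ := hT
  rw [trace_mul_eq_of_hasSum B hs hT]
  rw [trace_eq_of_hasSum (u := u) (v := fun n => ContinuousLinearMap.adjoint B (v n))]
  · simp only [ContinuousLinearMap.adjoint_inner_left]
  · refine (hs.mul_left ‖ContinuousLinearMap.adjoint B‖).of_nonneg_of_le
      (fun _ => by positivity) fun n => ?_
    rw [mul_left_comm]
    gcongr
    exact ContinuousLinearMap.le_opNorm _ _
  · simpa only [ContinuousLinearMap.mul_def, InnerProductSpace.rankOne_comp] using
      hT.mul_right B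

theorem trace_mul_rankOne (B : H →L[ℂ] H) (u v : H) :
    trace (B * InnerProductSpace.rankOne ℂ u v) = inner ℂ v (B u) := by
  refine HasSum.tsum_eq ?_
  have h := (traceBasis H).hasSum_inner_mul_inner v (B u)
  simpa [inner_smul_right, traceBasis] using h

variable (H) in
/-- The bilinear duality `(B, W) ↦ tr[B W]` between bounded and trace-class operators. -/
def tracePairing : (H →L[ℂ] H) →ₗ[ℂ] TraceClass H →ₗ[ℂ] ℂ :=
  LinearMap.mk₂ ℂ (fun B W => trace (B * (W : H →L[ℂ] H)))
    (fun B C W => by rw [add_mul, trace_add (W.2.mul_left B) (W.2.mul_left C)])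
    (fun c B W => by rw [smul_mul_assoc, trace_smul c (W.2.mul_left B), smul_eq_mul])
    (fun B W V => by
      rw [Submodule.coe_add, mul_add, trace_add (W.2.mul_left B) (V.2.mul_left B)])
    (fun c B W => by
      rw [Submodule.coe_smul, mul_smul_comm, trace_smul c (W.2.mul_left B), smul_eq_mul])

theorem tracePairing_apply (B : H →L[ℂ] H) (W : TraceClass H) :
    tracePairing H B W = trace (B * (W : H →L[ℂ] H)) := rfl

/-- In finite dimension the trace is continuous for the operator norm. -/
theorem hasSum_trace_mul [FiniteDimensional ℂ H] {ι : Type*} {T : ι → H →L[ℂ] H}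
    {S : H →L[ℂ] H} (h : HasSum T S) (B : H →L[ℂ] H) :
    HasSum (fun x => trace (B * T x)) (trace (B * S)) := by
  have : Finite (traceIndex H) :=
    (traceBasis H).orthonormal.linearIndependent.finite
  have := Fintype.ofFinite (traceIndex H)
  simp only [trace_eq_tsum, tsum_fintype]
  refine hasSum_sum fun i _ => ?_
  exact (innerSL ℂ (traceBasis H i)).hasSum
    ((ContinuousLinearMap.apply ℂ H (traceBasis H i)).hasSum (h.mul_left B))

/-- By cyclicity each term is `tr[Bᵢ Tᵢⱼ Bⱼ^*]`; on a basis vector `e` the double sum is the block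
form evaluated at the vectors `Bᵢ^* e`. -/
theorem BlockPositive.tracePairing_nonneg {n : ℕ} {T : Fin n → Fin n → TraceClass H}
    (hT : BlockPositive T) (B : Fin n → H →L[ℂ] H) :
    0 ≤ ∑ i, ∑ j, tracePairing H (star (B j) * B i) (T i j) := by
  have key : ∀ i j, HasSum (fun k => inner ℂ (star (B i) (traceBasis H k))
      ((T i j : H →L[ℂ] H) (star (B j) (traceBasis H k))))
      (tracePairing H (star (B j) * B i) (T i j)) := by
    intro i j
    rw [tracePairing_apply, mul_assoc, ← trace_mul_comm ((T i j).2.mul_left (B i))]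
    have h := (((T i j).2.mul_left (B i)).mul_right (star (B j))).hasSum_trace
    simpa [ContinuousLinearMap.star_eq_adjoint, ContinuousLinearMap.adjoint_inner_left] using h
  exact (hasSum_sum fun i _ => hasSum_sum fun j _ => key i j).nonneg fun k =>
    hT fun i => star (B i) (traceBasis H k)

theorem norm_sq_le_mul_of_forall_nonneg {a b z w : ℂ}
    (h : ∀ s t : ℂ, 0 ≤ star s * s * a + star t * s * w + star s * t * z + star t * t * b) :
    ‖z‖ ^ 2 ≤ a.re * b.re := by
  have h10 := h 1 0
  have h01 := h 0 1
  have h11 := h 1 1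
  have h1I := h 1 Complex.I
  simp only [Complex.le_def, Complex.star_def, Complex.zero_re, Complex.zero_im, map_one, map_zero,
    Complex.conj_I, one_mul, zero_mul, mul_zero, mul_one, add_zero, zero_add, Complex.add_re,
    Complex.add_im, Complex.mul_re, Complex.mul_im, Complex.neg_re, Complex.neg_im, Complex.I_re,
    Complex.I_im] at h10 h01 h11 h1I
  -- The imaginary parts at `(1, 1)` and `(1, i)` give `Im w = -Im z` and `Re w = Re z`.
  have hw : w = star z := by
    apply Complex.ext <;> simp <;> linarith
  have hM : (!![a, z; w, b] : Matrix (Fin 2) (Fin 2) ℂ).PosSemidef := by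
    refine Matrix.PosSemidef.of_dotProduct_mulVec_nonneg ?_ fun x => ?_
    · ext i j
      fin_cases i <;> fin_cases j <;> simp [hw, Complex.ext_iff] <;> linarith
    · have := h (x 0) (x 1)
      simp [dotProduct, Matrix.mulVec, Fin.sum_univ_two] at this ⊢
      convert this using 1
      ring
  have hd := hM.det_nonneg
  rw [Matrix.det_fin_two_of, hw, Complex.star_def, Complex.mul_conj, Complex.le_def] at hd
  rw [← Complex.normSq_eq_norm_sq]
  have := hd.1
  simp only [Complex.sub_re, Complex.mul_re, Complex.ofReal_re, Complex.zero_re] at this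
  rw [← h10.2, ← h01.2] at this
  linarith

/-- Cauchy–Schwarz inequality for the pairing with a positive `2 × 2` block operator. -/
theorem BlockPositive.norm_tracePairing_sq_le {T : Fin 2 → Fin 2 → TraceClass H}
    (hT : BlockPositive T) (B C : H →L[ℂ] H) :
    ‖tracePairing H (star B * C) (T 1 0)‖ ^ 2 ≤
      (tracePairing H (star B * B) (T 0 0)).re * (tracePairing H (star C * C) (T 1 1)).re := by
  refine norm_sq_le_mul_of_forall_nonneg (w := tracePairing H (star C * B) (T 0 1)) fun s t => ?_
  have h := hT.tracePairing_nonneg ![s • B, t • C]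
  simp only [Fin.sum_univ_two, Matrix.cons_val_zero, Matrix.cons_val_one, star_smul,
    smul_mul_assoc, mul_smul_comm, map_smul, LinearMap.smul_apply, smul_eq_mul] at h
  convert h using 1
  ring

end TraceTheory

/-! ### Positivity of operators and polarisation. -/

section Positivity

variable {H : Type*} [NormedAddCommGroup H] [InnerProductSpace ℂ H]

theorem isPositive_one_sub_sum {X : Type*} (E : Observable X H) (s : Finset X) :
    (1 - ∑ x ∈ s, E.effect x).IsPositive := by
  rw [ContinuousLinearMap.isPositive_iff]
  refine ⟨?_, fun ψ => ?_⟩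
  · have h1 : (∑ x ∈ s, E.effect x).IsPositive :=
      ContinuousLinearMap.isPositive_sum s fun x _ => E.isPositive x
    exact ((ContinuousLinearMap.isPositive_one (𝕜 := ℂ) (E := H)).isSymmetric).sub h1.isSymmetric
  · have h := (innerSL ℂ ψ).hasSum (E.hasSum_apply ψ)
    have hle := sum_le_hasSum s (fun x _ => (E.isPositive x).inner_nonneg_right ψ) h
    have h2 : inner ℂ ((1 - ∑ x ∈ s, E.effect x) ψ) ψ =
        inner ℂ ψ ψ - ∑ x ∈ s, inner ℂ ψ (E.effect x ψ) := by
      rw [← inner_sum, sub_apply, inner_sub_left, sum_apply, inner_sum, sum_inner]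
      congr 1
      exact Finset.sum_congr rfl fun x _ => (E.isPositive x).inner_left_eq_inner_right ψ ψ
    rw [h2]
    exact sub_nonneg.2 hle

/-- A linear functional on the trace-class operators that vanishes on pure states vanishes on all
rank-one operators. -/
theorem map_rankOneTC_eq_zero {F : TraceClass H →ₗ[ℂ] ℂ}
    (hF : ∀ u : H, ‖u‖ = 1 → F (rankOneTC u u) = 0) (u v : H) : F (rankOneTC u v) = 0 := by
  have h1 : ∀ u : H, F (rankOneTC u u) = 0 := by
    intro u
    rcases eq_or_ne u 0 with rfl | hu
    · have : rankOneTC (0 : H) 0 = 0 := Subtype.ext (by simp [coe_rankOneTC])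
      rw [this, map_zero]
    · have hn : ‖u‖ ≠ 0 := norm_ne_zero_iff.2 hu
      have h := hF ((‖u‖⁻¹ : ℂ) • u) (by simp [norm_smul, hn])
      have h2 : rankOneTC ((‖u‖⁻¹ : ℂ) • u) ((‖u‖⁻¹ : ℂ) • u) =
          ((‖u‖⁻¹ : ℂ) * (‖u‖⁻¹ : ℂ)) • rankOneTC u u :=
        Subtype.ext (by simp [coe_rankOneTC, smul_smul])
      rw [h2, map_smul, smul_eq_mul] at h
      simpa [hn] using h
  -- Polarisation: the values `c = 1` and `c = i` separate the two off-diagonal terms.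
  have h2 : ∀ c : ℂ, star c * F (rankOneTC u v) + c * F (rankOneTC v u) = 0 := by
    intro c
    have h3 : rankOneTC (u + c • v) (u + c • v) = rankOneTC u u + star c • rankOneTC u v +
        c • rankOneTC v u + (star c * c) • rankOneTC v v := by
      refine Subtype.ext ?_
      simp only [Submodule.coe_add, Submodule.coe_smul, coe_rankOneTC]
      ext x
      simp [smul_smul]
      module
    have h4 := h1 (u + c • v)
    rw [h3] at h4
    simpa [h1] using h4
  have ha := h2 1
  have hb := h2 Complex.I
  simp only [star_one, one_mul, Complex.star_def, Complex.conj_I] at ha hb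
  have hI := Complex.I_ne_zero
  have hc : Complex.I * (F (rankOneTC v u) - F (rankOneTC u v)) = 0 := by linear_combination hb
  have hd := (mul_eq_zero.1 hc).resolve_left hI
  linear_combination (1 / 2 : ℂ) * ha - (1 / 2 : ℂ) * hd

variable [CompleteSpace H]

theorem exists_eq_star_mul_self {A : H →L[ℂ] H} (hA : A.IsPositive) :
    ∃ B : H →L[ℂ] H, A = star B * B :=
  CStarAlgebra.nonneg_iff_eq_star_mul_self.1 ((ContinuousLinearMap.nonneg_iff_isPositive A).2 hA)

theorem isPositive_norm_smul_one_sub {A : H →L[ℂ] H} (hA : IsSelfAdjoint A) :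
    ((‖A‖ : ℂ) • (1 : H →L[ℂ] H) - A).IsPositive := by
  have h := hA.le_algebraMap_norm_self
  rw [ContinuousLinearMap.le_def, Algebra.algebraMap_eq_smul_one] at h
  simpa using h

theorem isPositive_norm_sq_smul_one_sub (A : H →L[ℂ] H) :
    (((‖A‖ ^ 2 : ℝ) : ℂ) • (1 : H →L[ℂ] H) - star A * A).IsPositive := by
  have h := isPositive_norm_smul_one_sub (IsSelfAdjoint.star_mul_self A)
  rwa [CStarRing.norm_star_mul_self, ← sq] at h

end Positivity

/-! ### Operators on the Hilbert space tensor product. -/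

section Tensor

variable {H K : Type*} [NormedAddCommGroup H] [InnerProductSpace ℂ H]
  [NormedAddCommGroup K] [InnerProductSpace ℂ K]

theorem opTensor_mul_opTensor (A A' : H →L[ℂ] H) (B B' : K →L[ℂ] K) :
    opTensor A B * opTensor A' B' = opTensor (A * A') (B * B') :=
  htensor_ext fun x y => by
    simp only [mul_apply_eq_comp, opTensor_tmul]

theorem htensor_ext_inner {z w : HTensor H K}
    (h : ∀ x y, inner ℂ (tmul x y) z = inner ℂ (tmul x y) w) : z = w := by
  have h' : innerSL ℂ (z - w) = 0 := by
    have key : ∀ t : H ⊗[ℂ] K, inner ℂ (z - w) (toHTensor H K t) = 0 := by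
      intro t
      induction t with
      | zero => rw [map_zero, inner_zero_right]
      | tmul x y =>
        rw [← inner_conj_symm]
        have := h x y
        rw [tmul] at this
        rw [inner_sub_right, this, sub_self, map_zero]
      | add a b ha hb => rw [map_add, inner_add_right, ha, hb, add_zero]
    exact DFunLike.coe_injective (denseRange_toHTensor.equalizer
      (innerSL ℂ (z - w)).continuous continuous_zero (funext key))
  have h2 := congrArg (fun f => f (z - w)) h'
  exact sub_eq_zero.1 (inner_self_eq_zero.1 h2)

/-- The bounded operator `a ↦ v ⊗ a`. -/
def tmulL (v : H) : K →L[ℂ] HTensor H K :=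
  LinearMap.mkContinuous
    { toFun := fun a => tmul v a
      map_add' := fun a b => tmul_add v a b
      map_smul' := fun c a => tmul_smul c v a } ‖v‖ fun a => (norm_tmul v a).le

theorem tmulL_apply (v : H) (a : K) : tmulL v a = tmul v a := rfl

theorem opTensor_one_one : opTensor (1 : H →L[ℂ] H) (1 : K →L[ℂ] K) = 1 :=
  htensor_ext fun x y => by rw [opTensor_tmul]; rfl

variable [CompleteSpace K]

theorem adjoint_tmulL_tmul (v x : H) (y : K) :
    ContinuousLinearMap.adjoint (tmulL (K := K) v) (tmul x y) = (inner ℂ v x : ℂ) • y :=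
  ext_inner_left ℂ fun a => by
    rw [ContinuousLinearMap.adjoint_inner_right, tmulL_apply, inner_tmul, inner_smul_right]

theorem opTensor_rankOne_left (u v : H) (S : K →L[ℂ] K) :
    opTensor (InnerProductSpace.rankOne ℂ u v) S =
      tmulL u ∘L S ∘L ContinuousLinearMap.adjoint (tmulL v) :=
  htensor_ext fun x y => by
    simp [opTensor_tmul, adjoint_tmulL_tmul, tmulL_apply, smul_tmul]

/-- The block form at `w` collapses to `⟨η, ξ η⟩`, where `η` is the sum of the slices of `w i` by `v
i`. -/
theorem blockPositive_rankOneTC_tensorTC {n : ℕ} (v : Fin n → H) {ξ : TraceClass K}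
    (hξ : (ξ : K →L[ℂ] K).IsPositive) :
    BlockPositive (fun i j => tensorTC (rankOneTC (v i) (v j)) ξ) := by
  intro w
  have h := hξ.inner_nonneg_right (∑ i, ContinuousLinearMap.adjoint (tmulL (v i)) (w i))
  rw [map_sum, sum_inner] at h
  simp only [inner_sum] at h
  convert h using 5 with i _ j _
  simp only [tensorTC, coe_rankOneTC, opTensor_rankOne_left, ContinuousLinearMap.comp_apply,
    ContinuousLinearMap.adjoint_inner_left]

/-- `T ↦ T ⊗ S` as a linear map. -/
def tensorRightTC (S : TraceClass K) : TraceClass H →ₗ[ℂ] TraceClass (HTensor H K) where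
  toFun T := tensorTC T S
  map_add' _ _ := Subtype.ext (opTensor_add_left _ _ _)
  map_smul' _ _ := Subtype.ext (opTensor_smul_left _ _ _)

theorem tracePairing_tensorTC (A : H →L[ℂ] H) (B : K →L[ℂ] K) (u v : H) (S : TraceClass K) :
    tracePairing (HTensor H K) (opTensor A B) (tensorTC (rankOneTC u v) S) =
      inner ℂ v (A u) * tracePairing K B S := by
  obtain ⟨S, a, b, hs, hS⟩ := S
  have h : HasSum (fun n => InnerProductSpace.rankOne ℂ (tmul u (a n)) (tmul v (b n)))
      (opTensor (InnerProductSpace.rankOne ℂ u v) S) := by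
    have h := (opTensorL H K (InnerProductSpace.rankOne ℂ u v)).hasSum hS
    simpa only [opTensorL_apply, opTensor_rankOne, Function.comp_def] using h
  have hs' : Summable fun n => ‖tmul u (a n)‖ * ‖tmul v (b n)‖ := by
    refine (hs.mul_left (‖u‖ * ‖v‖)).congr fun n => ?_
    rw [norm_tmul, norm_tmul]
    ring
  have h1 : tracePairing (HTensor H K) (opTensor A B) (tensorTC (rankOneTC u v) ⟨S, a, b, hs, hS⟩) =
      _ := trace_mul_eq_of_hasSum (opTensor A B) hs' h
  have h2 : tracePairing K B ⟨S, a, b, hs, hS⟩ = _ := trace_mul_eq_of_hasSum B hs hS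
  rw [h1, h2, ← tsum_mul_left]
  simp only [opTensor_tmul, inner_tmul]

variable [CompleteSpace H]

theorem star_opTensor (A : H →L[ℂ] H) (B : K →L[ℂ] K) :
    star (opTensor A B) = opTensor (star A) (star B) :=
  htensor_ext fun x y => htensor_ext_inner fun x' y' => by
    simp only [ContinuousLinearMap.star_eq_adjoint, ContinuousLinearMap.adjoint_inner_right,
      opTensor_tmul, inner_tmul]

theorem exists_opTensor_eq_star_mul_self {A : H →L[ℂ] H} {B : K →L[ℂ] K} (hA : A.IsPositive)
    (hB : B.IsPositive) : ∃ C : HTensor H K →L[ℂ] HTensor H K, opTensor A B = star C * C := by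
  obtain ⟨a, rfl⟩ := exists_eq_star_mul_self hA
  obtain ⟨b, rfl⟩ := exists_eq_star_mul_self hB
  exact ⟨opTensor a b, by rw [star_opTensor, opTensor_mul_opTensor]⟩

variable {T : Fin 2 → Fin 2 → TraceClass (HTensor H K)}

theorem BlockPositive.tracePairing_opTensor_nonneg (hT : BlockPositive T) (i : Fin 2)
    {A : H →L[ℂ] H} {B : K →L[ℂ] K} (hA : A.IsPositive) (hB : B.IsPositive) :
    0 ≤ tracePairing (HTensor H K) (opTensor A B) (T i i) := by
  obtain ⟨C, hC⟩ := exists_opTensor_eq_star_mul_self hA hB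
  have h := hT.tracePairing_nonneg (Pi.single i C)
  rw [hC]
  fin_cases i <;> simpa [Fin.sum_univ_two] using h

/-- With `A = a^* a`, factor `A ⊗ B = (a ⊗ 1)^* (a ⊗ B)`: Cauchy–Schwarz then has the factor `tr[(A
⊗ 1) T₀₀] = 0`. -/
theorem BlockPositive.tracePairing_opTensor_eq_zero_left (hT : BlockPositive T)
    {A : H →L[ℂ] H} (hA : A.IsPositive)
    (h0 : (tracePairing (HTensor H K) (opTensor A 1) (T 0 0)).re ≤ 0) (B : K →L[ℂ] K) :
    tracePairing (HTensor H K) (opTensor A B) (T 1 0) = 0 := by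
  have h1 := hT.tracePairing_opTensor_nonneg 0 hA ContinuousLinearMap.isPositive_one
  obtain ⟨a, rfl⟩ := exists_eq_star_mul_self hA
  have h := hT.norm_tracePairing_sq_le (opTensor a 1) (opTensor a B)
  simp only [star_opTensor, opTensor_mul_opTensor, star_one, one_mul] at h
  rw [le_antisymm h0 (Complex.le_def.1 h1).1, zero_mul] at h
  simpa using h

/-- Here `B` goes to the other factor, `A ⊗ B = (a ⊗ B^*)^* (a ⊗ 1)`, so that `T₁₁` meets `A ⊗ 1`.
-/
theorem BlockPositive.tracePairing_opTensor_eq_zero_right (hT : BlockPositive T)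
    {A : H →L[ℂ] H} (hA : A.IsPositive)
    (h0 : (tracePairing (HTensor H K) (opTensor A 1) (T 1 1)).re ≤ 0) (B : K →L[ℂ] K) :
    tracePairing (HTensor H K) (opTensor A B) (T 1 0) = 0 := by
  have h1 := hT.tracePairing_opTensor_nonneg 1 hA ContinuousLinearMap.isPositive_one
  obtain ⟨a, rfl⟩ := exists_eq_star_mul_self hA
  have h := hT.norm_tracePairing_sq_le (opTensor a (star B)) (opTensor a 1)
  simp only [star_opTensor, opTensor_mul_opTensor, star_one, mul_one, star_star] at h
  rw [le_antisymm h0 (Complex.le_def.1 h1).1, mul_zero] at h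
  simpa using h

/-- With `Z = z^* z`, apply Cauchy–Schwarz to `A ⊗ Z = (1 ⊗ z)^* (A ⊗ z)` and use `A^* A ≤ ‖A‖²`. -/
theorem BlockPositive.norm_tracePairing_opTensor_le (hT : BlockPositive T) (A : H →L[ℂ] H)
    {Z : K →L[ℂ] K} (hZ : Z.IsPositive) :
    ‖tracePairing (HTensor H K) (opTensor A Z) (T 1 0)‖ ≤
      ‖A‖ * (√(tracePairing (HTensor H K) (opTensor 1 Z) (T 0 0)).re *
        √(tracePairing (HTensor H K) (opTensor 1 Z) (T 1 1)).re) := by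
  have h0 := (Complex.le_def.1
    (hT.tracePairing_opTensor_nonneg 0 ContinuousLinearMap.isPositive_one hZ)).1
  have h1 := (Complex.le_def.1
    (hT.tracePairing_opTensor_nonneg 1 (isPositive_norm_sq_smul_one_sub A) hZ)).1
  rw [← opTensorL_apply, map_sub, map_smul] at h1
  simp only [sub_apply, smul_apply, opTensorL_apply,
    map_sub, map_smul, LinearMap.sub_apply, LinearMap.smul_apply, smul_eq_mul, Complex.sub_re,
    Complex.re_ofReal_mul, Complex.zero_re, sub_nonneg] at h1
  obtain ⟨z, rfl⟩ := exists_eq_star_mul_self hZ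
  have h := hT.norm_tracePairing_sq_le (opTensor 1 z) (opTensor A z)
  simp only [star_opTensor, opTensor_mul_opTensor, star_one, one_mul] at h
  rw [← Real.sqrt_mul h0, ← Real.sqrt_sq (norm_nonneg A), ← Real.sqrt_mul (sq_nonneg _)]
  refine Real.le_sqrt_of_sq_le (h.trans ?_)
  rw [mul_left_comm]
  exact mul_le_mul_of_nonneg_left h1 h0

end Tensor

/-! ### Measurement schemes: conservation and first-kind invariance. -/

section Scheme

variable {X : Type*} {H K : Type*} [NormedAddCommGroup H] [InnerProductSpace ℂ H]
  [NormedAddCommGroup K] [InnerProductSpace ℂ K]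
  [CompleteSpace K]

theorem isState_tensorTC_rankOneTC {ξ : TraceClass K} (hξ : IsState ξ) {u : H} (hu : ‖u‖ = 1) :
    IsState (tensorTC (rankOneTC u u) ξ) := by
  refine ⟨?_, ?_⟩
  · change (opTensor (InnerProductSpace.rankOne ℂ u u) (ξ : K →L[ℂ] K)).IsPositive
    rw [opTensor_rankOne_left]
    exact hξ.1.conj_adjoint (tmulL u)
  · have h := tracePairing_tensorTC (1 : H →L[ℂ] H) (1 : K →L[ℂ] K) u u ξ
    rw [opTensor_one_one, tracePairing_apply, tracePairing_apply, one_mul, one_mul, hξ.2] at h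
    rw [h]
    simp [inner_self_eq_norm_sq_to_K, hu]

/-- The trace-class operator `𝓔(|u⟩⟨v| ⊗ ξ)`. -/
def MeasurementScheme.evolve (M : MeasurementScheme X H K) (u v : H) :
    TraceClass (HTensor H K) :=
  M.interaction.toLin (tensorTC (rankOneTC u v) M.probe)

theorem MeasurementScheme.blockPositive_evolve (M : MeasurementScheme X H K) {n : ℕ}
    (v : Fin n → H) : BlockPositive (fun i j => M.evolve (v i) (v j)) :=
  M.interaction.completelyPositive n _ (blockPositive_rankOneTC_tensorTC v M.isState_probe.1)

theorem MeasurementScheme.tracePairing_one_evolve (M : MeasurementScheme X H K) (u v : H) :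
    tracePairing _ (opTensor 1 1) (M.evolve u v) = inner ℂ v u := by
  have h2 := M.isChannel_interaction (tensorTC (rankOneTC u v) M.probe)
  have h3 := tracePairing_tensorTC (1 : H →L[ℂ] H) (1 : K →L[ℂ] K) u v M.probe
  rw [opTensor_one_one, tracePairing_apply, tracePairing_apply, one_mul, one_mul, M.isState_probe.2,
    mul_one] at h3
  rw [opTensor_one_one, tracePairing_apply, one_mul]
  exact h2.trans h3

variable [CompleteSpace H]

theorem MeasurementScheme.tracePairing_additive_evolve (M : MeasurementScheme X H K)
    {NS : H →L[ℂ] H} {NA : K →L[ℂ] K}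
    (hN : M.interaction.ConservesOnAverage (additive NS NA)) (u v : H) :
    tracePairing _ (additive NS NA) (M.evolve u v) =
      inner ℂ v (NS u) + inner ℂ v u * tracePairing K NA M.probe := by
  -- Conservation concerns states only; applied to `T ↦ tr[N (𝓔 - id)(T ⊗ ξ)]`, polarisation extends
  -- it to `|u⟩⟨v|`.
  have h := map_rankOneTC_eq_zero
    (F := tracePairing _ (additive NS NA) ∘ₗ (M.interaction.toLin - LinearMap.id) ∘ₗ
      tensorRightTC M.probe) (fun w hw => by
        have h := hN _ (isState_tensorTC_rankOneTC M.isState_probe hw)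
        simp only [LinearMap.comp_apply, LinearMap.sub_apply, map_sub, LinearMap.id_apply]
        exact sub_eq_zero.2 h) u v
  simp only [LinearMap.comp_apply, LinearMap.sub_apply, map_sub, LinearMap.id_apply,
    sub_eq_zero] at h
  refine Eq.trans h ?_
  change tracePairing _ (additive NS NA) (tensorTC (rankOneTC u v) M.probe) = _
  have h1 : tracePairing K 1 M.probe = 1 := by
    rw [tracePairing_apply, one_mul, M.isState_probe.2]
  rw [additive, map_add, LinearMap.add_apply, tracePairing_tensorTC, tracePairing_tensorTC, h1,
    mul_one]
  rfl

variable {M : MeasurementScheme X H K} {I : Instrument X H}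

theorem MeasurementScheme.Implements.tracePairing_opTensor_pointer (hM : M.Implements I)
    (A : H →L[ℂ] H) (x : X) (u v : H) :
    tracePairing _ (opTensor A (M.pointer.effect x)) (M.evolve u v) =
      trace (A * ((I.op x).toLin (rankOneTC u v) : H →L[ℂ] H)) := by
  rw [hM x (rankOneTC u v) A, ← mul_assoc, opTensor_mul_opTensor, mul_one, one_mul]
  rfl

theorem MeasurementScheme.Implements.tracePairing_one_pointer (hM : M.Implements I)
    {E : Observable X H} (hIE : I.IsCompatible E) (x : X) (u v : H) :
    tracePairing _ (opTensor 1 (M.pointer.effect x)) (M.evolve u v) =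
      inner ℂ v (E.effect x u) := by
  rw [hM.tracePairing_opTensor_pointer, ← hIE x (rankOneTC u v)]
  exact trace_mul_rankOne _ _ _

/-- A positive operator fixed by the dual of the total channel does not decrease in expectation
under the measurement interaction. -/
theorem MeasurementScheme.Implements.re_inner_le [FiniteDimensional ℂ H] (hM : M.Implements I)
    {A : H →L[ℂ] H} (hA : A.IsPositive) (hfix : A ∈ I.total.dualFixedPoints) (u : H) :
    (inner ℂ u (A u)).re ≤ (tracePairing _ (opTensor A 1) (M.evolve u u)).re := by
  have hsum := Complex.hasSum_re (hasSum_trace_mul (I.hasSum_op (rankOneTC u u)) A)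
  rw [← hfix (rankOneTC u u), coe_rankOneTC, trace_mul_rankOne] at hsum
  refine hasSum_le_of_sum_le hsum fun s => ?_
  -- Only an inequality is needed: the remainder `1 - ∑ Z(x)` over a finite set is positive, so
  -- every partial sum is at most `tr[(A ⊗ 1) ω u u]`.
  have hpos := (M.blockPositive_evolve fun _ : Fin 2 => u).tracePairing_opTensor_nonneg 0 hA
    (isPositive_one_sub_sum M.pointer s)
  rw [← opTensorL_apply, map_sub, map_sum, map_sub, map_sum, LinearMap.sub_apply,
    LinearMap.sum_apply] at hpos
  simp only [opTensorL_apply, hM.tracePairing_opTensor_pointer] at hpos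
  have := (Complex.le_def.1 hpos).1
  rw [Complex.sub_re, Complex.re_sum, Complex.zero_re] at this
  linarith

theorem Instrument.one_sub_mem_dualFixedPoints (I : Instrument X H) {A : H →L[ℂ] H}
    (hA : A ∈ I.total.dualFixedPoints) : 1 - A ∈ I.total.dualFixedPoints := by
  intro T
  have h1 := hA T
  have h2 := I.isChannel T
  simp only [← tracePairing_apply, map_sub, LinearMap.sub_apply] at h1 ⊢
  rw [h1, tracePairing_apply 1, tracePairing_apply 1, one_mul, one_mul, h2]

/-- For an eigenvector `u` of `A` with eigenvalue `‖A‖`, the evolved state stays in the eigenspace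
of `A`. -/
theorem MeasurementScheme.Implements.re_tracePairing_norm_sub_le [FiniteDimensional ℂ H]
    (hM : M.Implements I) {A : H →L[ℂ] H} (hA : A.IsPositive)
    (hfix : A ∈ I.total.dualFixedPoints) {u : H} (hu : A u = (‖A‖ : ℂ) • u) :
    (tracePairing _ (opTensor ((‖A‖ : ℂ) • (1 : H →L[ℂ] H) - A) 1) (M.evolve u u)).re ≤ 0 := by
  have h := hM.re_inner_le hA hfix u
  rw [← opTensorL_apply, map_sub, map_smul]
  simp only [sub_apply, smul_apply, opTensorL_apply, map_sub, map_smul, LinearMap.sub_apply,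
    LinearMap.smul_apply, smul_eq_mul, M.tracePairing_one_evolve]
  rw [hu, inner_smul_right] at h
  rw [Complex.sub_re]
  linarith

/-- If the norms summed to one, `1 - A ≤ ‖1 - A‖` would read `‖A‖ ≤ A`, which with `A ≤ ‖A‖` makes
`A` scalar. -/
theorem norm_add_norm_one_sub_ne_one {A : H →L[ℂ] H} (hA : IsSelfAdjoint A)
    (hnt : NontrivialEffect A) : ‖A‖ + ‖1 - A‖ ≠ 1 := by
  intro h
  refine hnt (‖A‖ : ℂ) (le_antisymm (isPositive_norm_smul_one_sub hA) ?_)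
  have h2 := isPositive_norm_smul_one_sub ((IsSelfAdjoint.one (H →L[ℂ] H)).sub hA)
  rw [ContinuousLinearMap.le_def]
  convert h2 using 1
  rw [eq_sub_of_add_eq' h]
  push_cast
  module

end Scheme

end WAY

end

/-! ### The bound on the off-diagonal element of `N_S`. -/

theorem mainTheorem11 {X : Type*} [Countable X]
    {HS : Type*} [NormedAddCommGroup HS] [InnerProductSpace ℂ HS] [CompleteSpace HS]
    [FiniteDimensional ℂ HS]
    {HA : Type*} [NormedAddCommGroup HA] [InnerProductSpace ℂ HA] [CompleteSpace HA]
    [TopologicalSpace.SeparableSpace HA]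
    (E : WAY.Observable X HS) (hE : E.IsNontrivial)
    (I : WAY.Instrument X HS) (hIE : I.IsCompatible E)
    (M : WAY.MeasurementScheme X HS HA) (hM : M.Implements I)
    (hI : I.IsFirstKind E)
    (NS : HS →L[ℂ] HS) (hNS : IsSelfAdjoint NS)
    (NA : HA →L[ℂ] HA) (hNA : IsSelfAdjoint NA)
    (hN : M.interaction.ConservesOnAverage (WAY.additive NS NA))
    (x : X) (hx : WAY.NontrivialEffect (E.effect x))
    (ψ φ : HS) (hψ : ψ ∈ WAY.topEigenspace (E.effect x)) (hψ1 : ‖ψ‖ = 1)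
    (hφ : φ ∈ WAY.topEigenspace (1 - E.effect x)) (hφ1 : ‖φ‖ = 1) :
    ‖inner ℂ ψ (NS φ)‖ ≤
      ‖NS‖ * (√‖E.effect x‖ * √(1 - ‖1 - E.effect x‖) +
        √(1 - ‖E.effect x‖) * √‖1 - E.effect x‖) := by
  open WAY in
  have hEψ : E.effect x ψ = (‖E.effect x‖ : ℂ) • ψ := Module.End.mem_eigenspace_iff.1 hψ
  have hEφ' : (1 - E.effect x) φ = (‖1 - E.effect x‖ : ℂ) • φ := Module.End.mem_eigenspace_iff.1 hφ
  have hEφ : E.effect x φ = (1 - ‖1 - E.effect x‖ : ℂ) • φ := by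
    rw [sub_smul, ← hEφ', one_smul, sub_apply, one_apply_eq_self, sub_sub_cancel]
  have hpos := E.isPositive x
  have hpos' : (1 - E.effect x).IsPositive := by
    simpa using isPositive_one_sub_sum E {x}
  have hZ := M.pointer.isPositive x
  have hZ' : (1 - M.pointer.effect x).IsPositive := by
    simpa using isPositive_one_sub_sum M.pointer {x}
  have hne : (‖E.effect x‖ + ‖1 - E.effect x‖ - 1 : ℂ) ≠ 0 := by
    have h := norm_add_norm_one_sub_ne_one hpos.isSelfAdjoint hx
    exact_mod_cast sub_ne_zero.2 h
  have horth : inner ℂ ψ φ = 0 := by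
    have h := hpos.inner_left_eq_inner_right ψ φ
    rw [hEψ, hEφ, inner_smul_left, inner_smul_right, Complex.conj_ofReal] at h
    refine (mul_eq_zero.1 (?_ : (‖E.effect x‖ + ‖1 - E.effect x‖ - 1 : ℂ) * _ = 0)).resolve_left hne
    linear_combination h
  have hψψ : inner ℂ ψ ψ = (1 : ℂ) := by simp [inner_self_eq_norm_sq_to_K, hψ1]
  have hφφ : inner ℂ φ φ = (1 : ℂ) := by simp [inner_self_eq_norm_sq_to_K, hφ1]
  -- Index `0` is `ψ` and `1` is `φ`, so entry `(1, 0)` is `ω φ ψ`.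
  have hT := M.blockPositive_evolve ![ψ, φ]
  -- the apparatus contribution vanishes
  have hA0 : tracePairing _ (opTensor 1 NA) (M.evolve φ ψ) = 0 := by
    have hl := hT.tracePairing_opTensor_eq_zero_left
      (isPositive_norm_smul_one_sub hpos.isSelfAdjoint)
      (hM.re_tracePairing_norm_sub_le hpos (hI x) hEψ) NA
    have hr := hT.tracePairing_opTensor_eq_zero_right
      (isPositive_norm_smul_one_sub hpos'.isSelfAdjoint)
      (hM.re_tracePairing_norm_sub_le hpos' (I.one_sub_mem_dualFixedPoints (hI x)) hEφ') NA
    rw [← opTensorL_apply] at hl hr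
    simp only [map_sub, map_smul, sub_apply, smul_apply, opTensorL_apply, LinearMap.sub_apply,
      LinearMap.smul_apply, smul_eq_mul, Matrix.cons_val_zero, Matrix.cons_val_one] at hl hr
    -- Adding `hl` and `hr` cancels the `E(x) ⊗ N_A` terms.
    refine (mul_eq_zero.1 (?_ : (‖E.effect x‖ + ‖1 - E.effect x‖ - 1 : ℂ) * _ = 0)).resolve_left hne
    linear_combination hl + hr
  have hsplit : inner ℂ ψ (NS φ) =
      tracePairing _ (opTensor NS (M.pointer.effect x)) (M.evolve φ ψ) +
        tracePairing _ (opTensor NS (1 - M.pointer.effect x)) (M.evolve φ ψ) := by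
    have h := M.tracePairing_additive_evolve hN φ ψ
    rw [horth, zero_mul, add_zero, additive, map_add, LinearMap.add_apply, hA0, add_zero] at h
    rw [← h, ← LinearMap.add_apply, ← map_add, ← opTensor_add_right, add_sub_cancel]
  have hval : ∀ u : HS, (tracePairing _ (opTensor 1 (1 - M.pointer.effect x)) (M.evolve u u)) =
      inner ℂ u u - inner ℂ u (E.effect x u) := by
    intro u
    rw [← opTensorL_apply, map_sub, map_sub, LinearMap.sub_apply]
    simp only [opTensorL_apply, M.tracePairing_one_evolve, hM.tracePairing_one_pointer hIE]
  have h1 := hT.norm_tracePairing_opTensor_le NS hZ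
  have h2 := hT.norm_tracePairing_opTensor_le NS hZ'
  -- The probabilities of `x` are `‖E(x)‖` in `ψ` and `1 - ‖1 - E(x)‖` in `φ`; `h2` carries their
  -- complements.
  simp only [Matrix.cons_val_zero, Matrix.cons_val_one, hM.tracePairing_one_pointer hIE, hval, hEψ,
    hEφ, inner_smul_right, hψψ, hφφ, mul_one, sub_sub_cancel] at h1 h2
  rw [hsplit, mul_add]
  refine (norm_add_le _ _).trans (add_le_add ?_ ?_)
  · simpa using h1
  · simpa using h2
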